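/- Let $\mathcal V$ be a finite set of time series. A full-time causal graph (FTCG) with maximal lag $\gamma_{\max}\in\mathbb N$ is a directed acyclic graph $\mathcal G^f$ on the vertices $Z_s$ ($Z\in\mathcal V$, $s\in\mathbb Z$) whose edges $Z_{s}\to W_{r}$ satisfy $0\le r-s\le\gamma_{\max}$ and are invariant under time shifts. The extended summary causal graph (ESCG) derived from $\mathcal G^f$ has two vertices $Z_{t^-},Z_t$ for each $Z\in\mathcal V$, the edge $Z_t\to W_t$ iff $Z_t\to W_t$ in $\mathcal G^f$, the edge $Z_{t^-}\to W_t$ iff $Z_{t-\ell}\to W_t$ in $\mathcal G^f$ for some $1\le\ell\le\gamma_{\max}$, and no other edges. The candidate FTCGs of an ESCG $\mathcal G^e$ are those from which $\mathcal G^e$ is derived. A dynamic structural causal model (DSCM) with FTCG $\mathcal G^f$ consists of random variables $Z_s=f_Z(\mathrm{Par}(Z_s,\mathcal G^f),U_{Z,s})$ (almost surely) with values in standard Borel spaces, where the measurable mechanisms $f_Z$ and the laws of the noise variables $U_{Z,s}$ do not depend on $s$ (consistency throughout time), all the noise variables are jointly independent (causal sufficiency), and, for each $s$, the noise variables of times $\ge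 s$ are jointly independent of the observed variables of times $<s$. Let $P$ be the law of the observed variables. It is assumed to be positive: for fixed $\sigma$-finite reference measures $\nu_Z$ on the value spaces (e.g. counting or Lebesgue measures), every finite-dimensional marginal of $P$ has an almost everywhere positive density with respect to the product of the corresponding reference measures. The total effect $P(y_t\mid do(x_{t-\gamma}))$ is the law of $Y_t$ when $X_{t-\gamma}$ is held at the value $x_{t-\gamma}$, all variables of times before $t-\gamma$ are unchanged, and all other variables from time $t-\gamma$ on follow their structural equations. Theorem (Identifiability in ESCG). Let $\mathcal G^e$ be an ESCG over $\mathcal V$ with maximal lag $\gamma_{\max}$, let $X,Y\in\mathcal V$, $t\in\mathbb Z$ and $\gamma\ge 0$. Then $P(y_t\mid do(x_{t-\gamma}))$ is identifiable in $\mathcal G^e$: there is a functional of the observational law $P$ alone, the same for all candidate FTCGs of $\mathcal G^e$ and all DSCMs with positive law over them, that gives $P(y_t\mid do(x_{t-\gamma}))$ for $\nu_X$-almost every $x_{t-\gamma}$. Furthermore, the set $$\mathcal B_\gamma=\{Z_{t-\gamma-\ell} : 1\le\ell\le\gamma_{\max},\ Z_{t^-}\in \mathrm{Par}(X_t,\mathcal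 G^e)\}\cup\{Z_{t-\gamma} : Z_t\in \mathrm{Par}(X_t,\mathcal G^e)\}$$ is a valid adjustment set: in every DSCM with positive law over every candidate FTCG of $\mathcal G^e$, for $\nu_X$-almost every $x_{t-\gamma}$, $$P(y_t\mid do(x_{t-\gamma}))=\int P(y_t\mid x_{t-\gamma},\mathbf b)\,dP(\mathbf b),$$ where $\mathbf b$ ranges over the values of $\mathcal B_\gamma$. For countable value spaces with counting reference measures this says that, for every $x_{t-\gamma}$ and $y_t$, $P(y_t\mid do(x_{t-\gamma}))=\sum_{\mathbf b}P(y_t\mid x_{t-\gamma},\mathbf b)P(\mathbf b)$. -/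

import Mathlib

open MeasureTheory ProbabilityTheory

universe u v w

/-- A full-time causal graph over the time series `ι`, with maximal temporal lag `γmax`.  The vertex
`(i, s)` is the instance of the series `i` at time `s`.  The graph is acyclic, causes do not come
after their effects, lags are at most `γmax`, and edges are invariant under time shifts
(consistency throughout time of the causal relations). -/
structure FTCG (ι : Type u) (γmax : ℕ) extends Digraph (ι × ℤ) where
  time_le : ∀ {i j : ι} {s r : ℤ}, Adj (i, s) (j, r) → s ≤ r
  lag_le : ∀ {i j : ι} {s r : ℤ}, Adj (i, s) (j, r) → r - s ≤ γmax
  shift : ∀ {i j : ι} {s r : ℤ} (k : ℤ), Adj (i, s) (j, r) → Adj (i, s + k) (j, r + k)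
  acyclic : ∀ v, ¬ Relation.TransGen Adj v v

/-- The vertices of an extended summary causal graph: `past i` is `i_{t⁻}`, `present i` is `i_t`. -/
inductive ESCGVertex (ι : Type u) : Type u
  | past (i : ι)
  | present (i : ι)

/-- The extended summary causal graph derived from a full-time causal graph. By invariance under
time shifts the present can be placed at time `0`. -/
def FTCG.toESCG {ι : Type u} {γmax : ℕ} (G : FTCG ι γmax) : Digraph (ESCGVertex ι) where
  Adj
    | .past i, .present j => ∃ ℓ : ℕ, 0 < ℓ ∧ ℓ ≤ γmax ∧ G.Adj (i, -(ℓ : ℤ)) (j, 0)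
    | .present i, .present j => G.Adj (i, 0) (j, 0)
    | _, .past _ => False

/-- The candidate full-time causal graphs of `Ge`: those from which `Ge` is derived. -/
def candidateFTCGs {ι : Type u} (γmax : ℕ) (Ge : Digraph (ESCGVertex ι)) : Set (FTCG ι γmax) :=
  {G | G.toESCG = Ge}

/-- The (series, lag) pairs of the parents of the series `i` in a full-time causal graph. -/
abbrev FTCG.Parent {ι : Type u} {γmax : ℕ} (G : FTCG ι γmax) (i : ι) : Type u :=
  {p : ι × ℕ // G.Adj (p.1, -(p.2 : ℤ)) (i, 0)}

/-- Trajectories of a family of time series, the series `i` taking values in `S i`. -/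
abbrev Trajectory {ι : Type u} (S : ι → Type v) : Type (max u v) := ∀ q : ι × ℤ, S q.1

/-- A dynamic structural causal model with full-time causal graph `G`, with its random variables.

* Consistency throughout time: the mechanism and the noise law of a series do not depend on time.
* Causal sufficiency: all the noise variables are jointly independent.
* Since time has no beginning, the structural equations do not determine the joint law. The process
  is required to be generated forward in time: from any time `s` on, the noise is independent of
  the values taken before `s`. -/
structure DSCM {ι : Type u} {γmax : ℕ} (G : FTCG ι γmax) (𝒳 : ι → Type v)
    [∀ i, MeasurableSpace (𝒳 i)] where
  /-- values of the noise of each series -/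
  Noise : ι → Type w
  [noiseMeasurableSpace : ∀ i, MeasurableSpace (Noise i)]
  /-- law of the noise of each series -/
  noiseLaw : ∀ i, Measure (Noise i)
  /-- structural functions: arguments are the values of the parents and the noise -/
  mechanism : ∀ i, (∀ p : G.Parent i, 𝒳 p.1.1) → Noise i → 𝒳 i
  measurable_mechanism : ∀ i, Measurable (Function.uncurry (mechanism i))
  /-- the underlying probability space -/
  Ω : Type w
  [measurableSpaceΩ : MeasurableSpace Ω]
  μ : Measure Ω
  [isProbabilityMeasure : IsProbabilityMeasure μ]
  /-- the noise variables -/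
  U : ∀ q : ι × ℤ, Ω → Noise q.1
  /-- the observed variables -/
  V : ∀ q : ι × ℤ, Ω → 𝒳 q.1
  measurable_U : ∀ q, Measurable (U q)
  measurable_V : ∀ q, Measurable (V q)
  map_U : ∀ q, μ.map (U q) = noiseLaw q.1
  iIndepFun_U : iIndepFun U μ
  indepFun_past : ∀ s : ℤ,
    IndepFun (fun ω (q : {q : ι × ℤ // s ≤ q.2}) => U q.1 ω)
      (fun ω (q : {q : ι × ℤ // q.2 < s}) => V q.1 ω) μ
  structural_eq : ∀ (i : ι) (s : ℤ), ∀ᵐ ω ∂μ,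
    V (i, s) ω = mechanism i (fun p => V (p.1.1, s - p.1.2) ω) (U (i, s) ω)

attribute [instance] DSCM.noiseMeasurableSpace DSCM.measurableSpaceΩ DSCM.isProbabilityMeasure

/-- Following edges backwards without going before time `s` always terminates. -/
theorem FTCG.wellFounded_from {ι : Type u} [Finite ι] {γmax : ℕ} (G : FTCG ι γmax) (s : ℤ) :
    WellFounded (fun p q : ι × ℤ => G.Adj p q ∧ s ≤ p.2) := by
  have key : ∀ (T : ℤ), ∀ q : {q : ι × ℤ // s ≤ q.2 ∧ q.2 ≤ T},
      Acc (fun p q : ι × ℤ => G.Adj p q ∧ s ≤ p.2) q.1 := by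
    intro T
    have : Finite {q : ι × ℤ // s ≤ q.2 ∧ q.2 ≤ T} := by
      have h : (Set.univ ×ˢ Set.Icc s T : Set (ι × ℤ)).Finite :=
        Set.finite_univ.prod (Set.finite_Icc s T)
      exact (h.subset (fun q hq => ⟨trivial, hq⟩) : {q : ι × ℤ | s ≤ q.2 ∧ q.2 ≤ T}.Finite)
    let R : {q : ι × ℤ // s ≤ q.2 ∧ q.2 ≤ T} → {q : ι × ℤ // s ≤ q.2 ∧ q.2 ≤ T} → Prop :=
      fun p q => Relation.TransGen G.Adj p.1 q.1
    have : IsTrans _ R := ⟨fun _ _ _ h h' => Relation.TransGen.trans h h'⟩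
    have : Std.Irrefl R := ⟨fun q => G.acyclic q.1⟩
    have wf : WellFounded R := Finite.wellFounded_of_trans_of_irrefl R
    intro q
    induction q using wf.induction with
    | _ q ih =>
      refine Acc.intro _ fun p hp => ?_
      exact ih ⟨p, hp.2, (G.time_le hp.1).trans q.2.2⟩ (Relation.TransGen.single hp.1)
  refine ⟨fun q => Acc.intro _ fun p hp => ?_⟩
  exact key p.2 ⟨p, hp.2, le_rfl⟩

theorem FTCG.adj_of_parent {ι : Type u} {γmax : ℕ} (G : FTCG ι γmax) {i : ι} (p : G.Parent i)
    (s : ℤ) : G.Adj (p.1.1, s - p.1.2) (i, s) := by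
  have h := G.shift s p.2
  rwa [zero_add, neg_add_eq_sub] at h

namespace DSCM

variable {ι : Type u} {γmax : ℕ} {G : FTCG ι γmax} {𝒳 : ι → Type v} [∀ i, MeasurableSpace (𝒳 i)]

/-- The observational law: the joint law of all the observed variables. -/
noncomputable def obsLaw (M : DSCM.{u, v, w} G 𝒳) : Measure (Trajectory 𝒳) :=
  M.μ.map (fun ω q => M.V q ω)

instance (M : DSCM.{u, v, w} G 𝒳) : IsProbabilityMeasure M.obsLaw :=
  Measure.isProbabilityMeasure_map (measurable_pi_lambda _ M.measurable_V).aemeasurable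

open Classical in
/-- The trajectory under the intervention that sets the variable at the vertex `c` to the value `x`,
with given past and noise: nothing changes before the time of `c`; from that time on, all
variables obey their structural equations, except the one at `c`, which is held at `x`. -/
noncomputable def intervene [Finite ι] (M : DSCM.{u, v, w} G 𝒳) (c : ι × ℤ) (x : 𝒳 c.1)
    (past : Trajectory 𝒳) (noise : Trajectory M.Noise) : Trajectory 𝒳 :=
  (G.wellFounded_from c.2).fix fun q W =>
    if h : q = c then h ▸ x
    else if q.2 < c.2 then past q
    else M.mechanism q.1
      (fun p =>
        if hp : c.2 ≤ q.2 - p.1.2 then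
          W (p.1.1, q.2 - p.1.2) ⟨G.adj_of_parent p q.2, hp⟩
        else past (p.1.1, q.2 - p.1.2))
      (noise q)

/-- The total effect `P(Y | do(X = x))` for the variables `X` and `Y` at the vertices `c` and `d`:
the law of `Y` under the intervention that sets `X` to `x`. -/
noncomputable def totalEffect [Finite ι] (M : DSCM.{u, v, w} G 𝒳) (c d : ι × ℤ) (x : 𝒳 c.1) :
    Measure (𝒳 d.1) :=
  M.μ.map (fun ω => M.intervene c x (fun q => M.V q ω) (fun q => M.U q ω) d)

end DSCM

section

variable {ι : Type u} {𝒳 : ι → Type v} [∀ i, MeasurableSpace (𝒳 i)]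

/-- `P` is positive with respect to the reference measures `ν` (e.g. counting measure for discrete
series, Lebesgue measure for continuous ones): each finite-dimensional marginal has a density
with respect to the product of the reference measures, which is almost everywhere positive. -/
def IsPositiveLaw (ν : ∀ i, Measure (𝒳 i)) (P : Measure (Trajectory 𝒳)) : Prop :=
  ∀ (S : Set (ι × ℤ)) [Fintype S],
    (P.map fun τ (q : S) => τ q) ≪ Measure.pi (fun q : S => ν q.1.1) ∧
    Measure.pi (fun q : S => ν q.1.1) ≪ (P.map fun τ (q : S) => τ q)

/-- The right-hand side `∑_z P(y | x, z) P(z)` of the adjustment formula for the vertices `c` (of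
`x`) and `d` (of `y`) and the set `B` of adjustment vertices, as a measure in `y`: the mixture
over `z`, drawn from the law of the variables in `B`, of the conditional laws given `(x, z)`. -/
noncomputable def adjustmentFormula (P : Measure (Trajectory 𝒳)) [IsFiniteMeasure P]
    (c d : ι × ℤ) [StandardBorelSpace (𝒳 d.1)] [Nonempty (𝒳 d.1)] (B : Set (ι × ℤ)) (x : 𝒳 c.1) :
    Measure (𝒳 d.1) :=
  (P.map fun τ (q : B) => τ q).bind fun z =>
    condDistrib (fun τ : Trajectory 𝒳 => τ d) (fun τ => (τ c, fun q : B => τ q)) P (x, z)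

/-- For countably many discrete states this is literally `∑_z P(y | x, z) P(z)`. -/
theorem adjustmentFormula_singleton_of_countable [∀ i, Countable (𝒳 i)]
    [∀ i, MeasurableSingletonClass (𝒳 i)] (P : Measure (Trajectory 𝒳)) [IsFiniteMeasure P]
    (c d : ι × ℤ) [StandardBorelSpace (𝒳 d.1)] [Nonempty (𝒳 d.1)] (B : Set (ι × ℤ)) [Finite B]
    (x : 𝒳 c.1) (y : 𝒳 d.1)
    (hpos : ∀ z : ∀ q : B, 𝒳 q.1.1, P {τ | τ c = x ∧ ∀ q : B, τ q = z q} ≠ 0) :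
    adjustmentFormula P c d B x {y} = ∑' z : (∀ q : B, 𝒳 q.1.1),
      P {τ | τ d = y ∧ τ c = x ∧ ∀ q : B, τ q = z q} / P {τ | τ c = x ∧ ∀ q : B, τ q = z q} *
        P {τ | ∀ q : B, τ q = z q} := by
  have hB : Measurable fun (τ : Trajectory 𝒳) (q : B) => τ q :=
    measurable_pi_lambda _ fun q => measurable_pi_apply _
  have hc : Measurable fun τ : Trajectory 𝒳 => (τ c, fun q : B => τ q) :=
    (measurable_pi_apply c).prodMk hB
  have hd : Measurable fun τ : Trajectory 𝒳 => τ d := measurable_pi_apply d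
  have e1 : ∀ z : (∀ q : B, 𝒳 q.1.1), (fun τ : Trajectory 𝒳 => (τ c, fun q : B => τ q)) ⁻¹' {(x, z)}
      = {τ | τ c = x ∧ ∀ q : B, τ q = z q} := by
    intro z; ext τ; simp [funext_iff]
  have e2 : ∀ z : (∀ q : B, 𝒳 q.1.1),
      (fun τ : Trajectory 𝒳 => ((τ c, fun q : B => τ q), τ d)) ⁻¹' ({(x, z)} ×ˢ {y})
      = {τ | τ d = y ∧ τ c = x ∧ ∀ q : B, τ q = z q} := by
    intro z; ext τ; simp [funext_iff]; tauto
  have e3 : ∀ z : (∀ q : B, 𝒳 q.1.1), (fun (τ : Trajectory 𝒳) (q : B) => τ q) ⁻¹' {z}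
      = {τ | ∀ q : B, τ q = z q} := by
    intro z; ext τ; simp [funext_iff]
  rw [adjustmentFormula, Measure.bind_apply (measurableSet_singleton y)
    (by exact ((Kernel.measurable _).comp measurable_prodMk_left).aemeasurable),
    lintegral_countable']
  refine tsum_congr fun z => ?_
  have h0 : P.map (fun τ : Trajectory 𝒳 => (τ c, fun q : B => τ q)) {(x, z)} ≠ 0 := by
    rw [Measure.map_apply hc (measurableSet_singleton _), e1]; exact hpos z
  rw [condDistrib_apply_of_ne_zero hd _ h0, Measure.map_apply hc (measurableSet_singleton _),
    Measure.map_apply hB (measurableSet_singleton _),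
    Measure.map_apply (hc.prodMk hd) ((measurableSet_singleton _).prod (measurableSet_singleton _)),
    e1, e2, e3, ENNReal.div_eq_inv_mul]

variable [Finite ι] [∀ i, StandardBorelSpace (𝒳 i)] [∀ i, Nonempty (𝒳 i)]

/-- `P(y | do(x))`, for the vertices `c` of `x` and `d` of `y`, is identifiable in `Ge`: one and the
same functional `Φ` of the observational law computes it in all models with positive law over all
candidate full-time causal graphs. Densities and conditional laws being defined up to null sets,
this is for almost all `x` (all `x`, in the discrete case with counting measure). -/
def IsIdentifiable (γmax : ℕ) (ν : ∀ i, Measure (𝒳 i)) (Ge : Digraph (ESCGVertex ι))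
    (c d : ι × ℤ) : Prop :=
  ∃ Φ : Measure (Trajectory 𝒳) → 𝒳 c.1 → Measure (𝒳 d.1),
    ∀ G ∈ candidateFTCGs γmax Ge, ∀ M : DSCM.{u, v, w} G 𝒳, IsPositiveLaw ν M.obsLaw →
      ∀ᵐ x ∂(ν c.1), M.totalEffect c d x = Φ M.obsLaw x

/-- `B` is a valid adjustment set for `P(y | do(x))`, for the vertices `c` of `x` and `d` of `y`: the
adjustment formula holds in all models with positive law over all candidate full-time causal
graphs of `Ge`. -/
def IsValidAdjustmentSet (γmax : ℕ) (ν : ∀ i, Measure (𝒳 i)) (Ge : Digraph (ESCGVertex ι))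
    (c d : ι × ℤ) (B : Set (ι × ℤ)) : Prop :=
  ∀ G ∈ candidateFTCGs γmax Ge, ∀ M : DSCM.{u, v, w} G 𝒳, IsPositiveLaw ν M.obsLaw →
    ∀ᵐ x ∂(ν c.1), M.totalEffect c d x = adjustmentFormula M.obsLaw c d B x

end

/-- The set `B_γ` attached to `P(y_t | do(x_{t-γ}))`: all the `Z_{t-γ-ℓ}`, `1 ≤ ℓ ≤ γmax`, for the
lagged parents `Z_{t⁻}` of `X_t`, and the `Z_{t-γ}` for the instantaneous parents `Z_t` of `X_t`. -/
def adjustmentB {ι : Type u} (γmax : ℕ) (Ge : Digraph (ESCGVertex ι)) (X : ι) (t : ℤ) (γ : ℕ) :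
    Set (ι × ℤ) :=
  {q | ∃ Z, Ge.Adj (.past Z) (.present X) ∧ ∃ ℓ : ℕ, 1 ≤ ℓ ∧ ℓ ≤ γmax ∧ q = (Z, t - γ - ℓ)} ∪
  {q | ∃ Z, Ge.Adj (.present Z) (.present X) ∧ q = (Z, t - γ)}

/-!
Let `Q` consist of the observed variables before the time of `X` and of the noise from then on,
except the noise `U` at `X`; it is independent of `U`. The variables `B` of the adjustment set
contain the parents of `X` and are not descendants of `X`. They are thus a function `b Q`, and
`X = F (b Q, U)`. By consistency `Y = g (X, Q)`, and the total effect of `x` is the law of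
`g (x, Q)`.

Given `Q`, the law of `X` depends on `b Q` only. By positivity, the product of the laws of `Q` and
`X` therefore has a density with respect to their joint law that is a function of `(X, b Q)`.
Reweighting by a function of the conditioning variables does not change a conditional law, so
the conditional law of `Y` given `(X, B)` is the same under the product law. There `Q` is
independent of `X`, so that the law of `Y` given `X = x` is that of `g (x, Q)`, and `B` is
independent of `X` too: mixing the conditional laws of `Y` over the law of `B` yields this law.
-/

section BackDoor

variable {A D E R : Type*} [MeasurableSpace A] [MeasurableSpace D] [MeasurableSpace E]
  [MeasurableSpace R]

/-- The kernel whose value at `x` is the mixture of the laws `η (x, z)` over `z` of law `β`. For a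
deterministic kernel `η` it is the law of a function of `x` and of a random variable of law `β`. -/
noncomputable def mixtureKernel (η : Kernel (A × E) D) (β : Measure E) : Kernel A D :=
  (Kernel.const A β ⊗ₖ η).snd

instance (η : Kernel (A × E) D) [IsMarkovKernel η] (β : Measure E) [IsProbabilityMeasure β] :
    IsMarkovKernel (mixtureKernel η β) := by
  unfold mixtureKernel; infer_instance

theorem mixtureKernel_apply (η : Kernel (A × E) D) [IsSFiniteKernel η] (β : Measure E) [SFinite β]
    (x : A) : mixtureKernel η β x = β.bind fun z => η (x, z) := by
  ext s hs
  rw [mixtureKernel, Kernel.snd_apply' _ _ hs, Kernel.compProd_apply (measurable_snd hs),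
    Kernel.const_apply, Measure.bind_apply hs (by exact (η.sectR x).aemeasurable)]
  rfl

theorem mixtureKernel_deterministic_apply {g : A × E → D} (hg : Measurable g) (β : Measure E)
    [SFinite β] (x : A) :
    mixtureKernel (Kernel.deterministic g hg) β x = β.map fun z => g (x, z) := by
  rw [mixtureKernel_apply]
  exact Measure.bind_dirac_eq_map β (hg.comp measurable_prodMk_left)

theorem compProd_mixtureKernel (α : Measure A) [SFinite α] (β : Measure E) [SFinite β]
    (η : Kernel (A × E) D) :
    α ⊗ₘ mixtureKernel η β = ((α.prod β) ⊗ₘ η).map fun p => (p.1.1, p.2) := by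
  rw [mixtureKernel, Kernel.snd_eq, Measure.compProd_map measurable_snd, ← Measure.compProd_const,
    ← Measure.compProd_assoc', Measure.map_map (by fun_prop) (by fun_prop)]
  rfl

theorem compProd_mixtureKernel_deterministic (α : Measure A) [SFinite α] (β : Measure E)
    [SFinite β] {g : A × E → D} (hg : Measurable g) :
    α ⊗ₘ mixtureKernel (Kernel.deterministic g hg) β = (α.prod β).map fun p => (p.1, g p) := by
  rw [compProd_mixtureKernel, Measure.compProd_deterministic, Measure.map_map (by fun_prop)
    (by fun_prop)]
  rfl

theorem map_withDensity_comp (μ : Measure R) {f : R → E} (hf : Measurable f)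
    {σ : E → ENNReal} (hσ : Measurable σ) :
    (μ.withDensity (σ ∘ f)).map f = (μ.map f).withDensity σ := by
  ext s hs
  rw [Measure.map_apply hf hs, withDensity_apply _ (hf hs), withDensity_apply _ hs,
    setLIntegral_map hs hσ hf]
  rfl

theorem withDensity_compProd (μ : Measure E) [SFinite μ] (κ : Kernel E D) [IsSFiniteKernel κ]
    {σ : E → ENNReal} (hσ : Measurable σ) :
    μ.withDensity σ ⊗ₘ κ = (μ ⊗ₘ κ).withDensity (σ ∘ Prod.fst) := by
  refine Measure.ext_of_lintegral _ fun φ hφ => ?_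
  rw [Measure.lintegral_compProd hφ, lintegral_withDensity_eq_lintegral_mul _ hσ
    hφ.lintegral_kernel_prod_right', lintegral_withDensity_eq_lintegral_mul _
    (hσ.comp measurable_fst) hφ, Measure.lintegral_compProd ((hσ.comp measurable_fst).mul hφ)]
  exact lintegral_congr fun x =>
    (lintegral_const_mul _ (hφ.comp measurable_prodMk_left)).symm

theorem map_prodMk_withDensity_eq_compProd {μ : Measure R} [SFinite μ] {f : R → E} {Y : R → D}
    (hf : Measurable f) (hY : Measurable Y) {κ : Kernel E D} [IsSFiniteKernel κ] {σ : E → ENNReal}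
    (hσ : Measurable σ)
    (hκ : μ.map (fun r => (f r, Y r)) = μ.map f ⊗ₘ κ) :
    (μ.withDensity (σ ∘ f)).map (fun r => (f r, Y r)) = (μ.withDensity (σ ∘ f)).map f ⊗ₘ κ := by
  rw [map_withDensity_comp μ hf hσ, withDensity_compProd _ _ hσ, ← hκ]
  exact map_withDensity_comp μ (hf.prodMk hY) (hσ.comp measurable_fst)

theorem prod_eq_withDensity_compProd_comap [MeasurableSpace.CountableOrCountablyGenerated E A]
    (ρ : Measure R) [IsFiniteMeasure ρ] (α : Measure A) [IsFiniteMeasure α]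
    {b : R → E} (hb : Measurable b) (K : Kernel E A) [IsFiniteKernel K]
    (hac : (ρ.map b).prod α ≪ ρ.map b ⊗ₘ K) :
    ρ.prod α = (ρ ⊗ₘ K.comap b hb).withDensity
      fun p => (Kernel.const E α).rnDeriv K (b p.1) p.2 := by
  let σ := (Kernel.const E α).rnDeriv K
  have hσ : Measurable (Function.uncurry σ) := Kernel.measurable_rnDeriv _ _
  have hσb : Measurable (Function.uncurry fun r => σ (b r)) := hσ.comp (hb.prodMap measurable_id)
  have hcomap : (K.withDensity σ).comap b hb = (K.comap b hb).withDensity fun r => σ (b r) := by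
    ext r : 1
    rw [Kernel.comap_apply, Kernel.withDensity_apply _ hσ, Kernel.withDensity_apply _ hσb,
      Kernel.comap_apply]
  have hα : Kernel.const R α =ᵐ[ρ] (K.withDensity σ).comap b hb := by
    rw [← Measure.compProd_const] at hac
    filter_upwards [ae_of_ae_map hb.aemeasurable hac.kernel_of_compProd] with r hr
    exact (Kernel.withDensity_rnDeriv_eq hr).symm
  have : IsFiniteKernel ((K.comap b hb).withDensity fun r => σ (b r)) := hcomap ▸ inferInstance
  rw [← Measure.compProd_const, Measure.compProd_congr hα, hcomap,
    Measure.compProd_withDensity hσb]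

theorem ae_map_eq_bind_of_compProd [MeasurableSpace.CountableOrCountablyGenerated E A]
    [MeasurableSpace.CountableOrCountablyGenerated A D]
    {ρ : Measure R} [IsProbabilityMeasure ρ] {α : Measure A} [IsFiniteMeasure α]
    {b : R → E} (hb : Measurable b) {g : A × R → D} (hg : Measurable g)
    {K : Kernel E A} [IsFiniteKernel K] (hac : (ρ.map b).prod α ≪ ρ.map b ⊗ₘ K)
    {η : Kernel (A × E) D} [IsMarkovKernel η]
    (hη : (ρ ⊗ₘ K.comap b hb).map (fun p => ((p.2, b p.1), g p.swap)) =
      (ρ ⊗ₘ K.comap b hb).map (fun p => (p.2, b p.1)) ⊗ₘ η) :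
    ∀ᵐ x ∂α, ρ.map (fun r => g (x, r)) = (ρ.map b).bind fun z => η (x, z) := by
  have : IsProbabilityMeasure (ρ.map b) := Measure.isProbabilityMeasure_map hb.aemeasurable
  let σ : A × E → ENNReal := fun z => (Kernel.const E α).rnDeriv K z.2 z.1
  have hσ : Measurable σ := (Kernel.measurable_rnDeriv _ _).comp measurable_swap
  have hη' : (ρ.prod α).map (fun p => ((p.2, b p.1), g p.swap)) =
      (ρ.prod α).map (fun p => (p.2, b p.1)) ⊗ₘ η := by
    rw [prod_eq_withDensity_compProd_comap ρ α hb K hac]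
    exact map_prodMk_withDensity_eq_compProd (σ := σ) (by fun_prop) (by fun_prop) hσ hη
  have hprod : α.prod (ρ.map b) = (ρ.prod α).map fun p => (p.2, b p.1) := by
    have hmap := Measure.map_prod_map ρ α hb measurable_id
    rw [Measure.map_id] at hmap
    rw [← Measure.prod_swap, hmap, Measure.map_map (by fun_prop) (by fun_prop)]
    rfl
  have hmix : α ⊗ₘ mixtureKernel (Kernel.deterministic g hg) ρ =
      α ⊗ₘ mixtureKernel η (ρ.map b) := by
    rw [compProd_mixtureKernel α (ρ.map b), hprod, ← hη', compProd_mixtureKernel_deterministic,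
      ← Measure.prod_swap, Measure.map_map (by fun_prop) (by fun_prop),
      Measure.map_map (by fun_prop) (by fun_prop)]
    rfl
  filter_upwards [Kernel.ae_eq_of_compProd_eq hmix] with x hx
  rw [← mixtureKernel_deterministic_apply hg, hx, mixtureKernel_apply]

theorem comap_mixtureKernel_deterministic {F : E × A → D} (hF : Measurable F)
    (β : Measure A) [SFinite β] {b : R → E} (hb : Measurable b) :
    (mixtureKernel (Kernel.deterministic F hF) β).comap b hb =
      mixtureKernel
        (Kernel.deterministic (F ∘ Prod.map b id) (hF.comp (hb.prodMap measurable_id))) β := by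
  ext r : 1
  rw [Kernel.comap_apply, mixtureKernel_deterministic_apply, mixtureKernel_deterministic_apply]
  rfl

variable {Ω N : Type*} [MeasurableSpace Ω] [MeasurableSpace N] {μ : Measure Ω}
  [IsProbabilityMeasure μ]

theorem map_prodMk_eq_compProd_mixtureKernel {Q : Ω → R} {U : Ω → N} {X : Ω → A} {F : R × N → A}
    (hQ : Measurable Q) (hU : Measurable U) (hF : Measurable F) (hind : IndepFun Q U μ)
    (hX : ∀ᵐ ω ∂μ, X ω = F (Q ω, U ω)) :
    μ.map (fun ω => (Q ω, X ω)) =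
      μ.map Q ⊗ₘ mixtureKernel (Kernel.deterministic F hF) (μ.map U) := by
  rw [compProd_mixtureKernel_deterministic,
    ← (indepFun_iff_map_prod_eq_prod_map_map hQ.aemeasurable hU.aemeasurable).1 hind,
    Measure.map_map (by fun_prop) (hQ.prodMk hU)]
  refine Measure.map_congr ?_
  filter_upwards [hX] with ω hω
  rw [hω]
  rfl

theorem ae_map_eq_bind_of_indepFun [MeasurableSpace.CountableOrCountablyGenerated E A]
    [MeasurableSpace.CountableOrCountablyGenerated A D] {X : Ω → A} {B : Ω → E} {Y : Ω → D}
    {Q : Ω → R} {U : Ω → N} {b : R → E} {F : E × N → A} {g : A × R → D}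
    (hX : Measurable X) (hQ : Measurable Q) (hU : Measurable U)
    (hb : Measurable b) (hF : Measurable F) (hg : Measurable g) (hind : IndepFun Q U μ)
    (hBb : B =ᵐ[μ] fun ω => b (Q ω)) (hXF : X =ᵐ[μ] fun ω => F (B ω, U ω))
    (hYg : Y =ᵐ[μ] fun ω => g (X ω, Q ω))
    (hac : (μ.map B).prod (μ.map X) ≪ μ.map fun ω => (B ω, X ω))
    {η : Kernel (A × E) D} [IsMarkovKernel η]
    (hη : μ.map (fun ω => ((X ω, B ω), Y ω)) = μ.map (fun ω => (X ω, B ω)) ⊗ₘ η) :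
    ∀ᵐ x ∂μ.map X, μ.map (fun ω => g (x, Q ω)) = (μ.map B).bind fun z => η (x, z) := by
  have := Measure.isProbabilityMeasure_map (μ := μ) hX.aemeasurable
  have := Measure.isProbabilityMeasure_map (μ := μ) hQ.aemeasurable
  have := Measure.isProbabilityMeasure_map (μ := μ) hU.aemeasurable
  let K := mixtureKernel (Kernel.deterministic F hF) (μ.map U)
  have hXbQ : ∀ᵐ ω ∂μ, X ω = F (b (Q ω), U ω) := by
    filter_upwards [hXF, hBb] with ω hXω hBω
    rw [hXω, hBω]
  have hB_law : μ.map B = (μ.map Q).map b := by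
    rw [Measure.map_congr hBb, Measure.map_map hb hQ]
    rfl
  have hQX_law : μ.map (fun ω => (Q ω, X ω)) = μ.map Q ⊗ₘ K.comap b hb := by
    rw [comap_mixtureKernel_deterministic]
    exact map_prodMk_eq_compProd_mixtureKernel hQ hU _ hind hXbQ
  have hBX_law : μ.map (fun ω => (B ω, X ω)) = (μ.map Q).map b ⊗ₘ K := by
    rw [Measure.map_map hb hQ, ← map_prodMk_eq_compProd_mixtureKernel (hb.comp hQ) hU hF
      (hind.comp hb measurable_id) hXbQ]
    exact Measure.map_congr (hBb.prodMk .rfl)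
  have hη' : (μ.map Q ⊗ₘ K.comap b hb).map (fun p => ((p.2, b p.1), g p.swap)) =
      (μ.map Q ⊗ₘ K.comap b hb).map (fun p => (p.2, b p.1)) ⊗ₘ η := by
    rw [← hQX_law, Measure.map_map (by fun_prop) (hQ.prodMk hX),
      Measure.map_map (by fun_prop) (hQ.prodMk hX)]
    have hXB : (fun ω => (X ω, B ω)) =ᵐ[μ] fun ω => (X ω, b (Q ω)) := .prodMk .rfl hBb
    rw [Measure.map_congr (hXB.prodMk hYg), Measure.map_congr hXB] at hη
    exact hη
  rw [hBX_law, hB_law] at hac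
  rw [hB_law]
  filter_upwards [ae_map_eq_bind_of_compProd hb hg hac hη'] with x hx
  rw [← hx, Measure.map_map (by fun_prop) hQ]
  rfl

end BackDoor

section Independence

variable {Ω : Type*} [MeasurableSpace Ω] {μ : Measure Ω}

theorem indepFun_prodMk_of_indepFun_of_prodMk_indepFun [IsFiniteMeasure μ] {α β δ : Type*}
    [MeasurableSpace α] [MeasurableSpace β] [MeasurableSpace δ] {U : Ω → α} {W : Ω → β} {Z : Ω → δ}
    (hU : Measurable U) (hW : Measurable W) (hZ : Measurable Z) (hUW : IndepFun U W μ)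
    (hUWZ : IndepFun (fun ω => (U ω, W ω)) Z μ) : IndepFun U (fun ω => (W ω, Z ω)) μ := by
  have hWZ : IndepFun W Z μ := hUWZ.comp measurable_snd measurable_id
  rw [indepFun_iff_map_prod_eq_prod_map_map hU.aemeasurable (hW.prodMk hZ).aemeasurable,
    (indepFun_iff_map_prod_eq_prod_map_map hW.aemeasurable hZ.aemeasurable).1 hWZ,
    ← Measure.prodAssoc_prod,
    ← (indepFun_iff_map_prod_eq_prod_map_map hU.aemeasurable hW.aemeasurable).1 hUW,
    ← (indepFun_iff_map_prod_eq_prod_map_map (hU.prodMk hW).aemeasurable hZ.aemeasurable).1 hUWZ,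
    Measure.map_map MeasurableEquiv.prodAssoc.measurable ((hU.prodMk hW).prodMk hZ)]
  rfl

variable {κ : Type*} {β : κ → Type*} [∀ k, MeasurableSpace (β k)]

theorem indepFun_domRestrict_of_notMem {f : ∀ k, Ω → β k} (hf : ∀ k, Measurable (f k))
    (hind : iIndepFun f μ) {c : κ} {S : Set κ} (hc : c ∉ S) :
    IndepFun (f c) (fun ω => S.domRestrict fun k => f k ω) μ := by
  have hle : MeasurableSpace.comap (fun ω => S.domRestrict fun k => f k ω) MeasurableSpace.pi ≤
      ⨆ k ∈ S, MeasurableSpace.comap (f k) inferInstance := by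
    rw [MeasurableSpace.pi, MeasurableSpace.comap_iSup]
    refine iSup_le fun k => ?_
    rw [MeasurableSpace.comap_comp]
    exact le_iSup₂_of_le k.1 k.2 le_rfl
  have hsup := indep_iSup_of_disjoint (fun k => (hf k).comap_le) hind.iIndep
    (Set.disjoint_singleton_left.2 hc)
  rw [iSup_singleton] at hsup
  exact (IndepFun_iff_Indep _ _ _).2 (indep_of_indep_of_le_right hsup hle)

theorem exists_measurable_comp_domRestrict_eq_piecewise (S : Set κ) [DecidablePred (· ∈ S)]
    (f₀ : ∀ k, β k) :
    ∃ φ : (∀ k : S, β k) → ∀ k, β k, Measurable φ ∧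
      ∀ f, φ (S.domRestrict f) = S.piecewise f f₀ := by
  refine ⟨fun z => (Equiv.piEquivPiSubtypeProd (· ∈ S) β).symm (z, fun k => f₀ k),
    (measurable_piEquivPiSubtypeProd_symm β (· ∈ S)).comp measurable_prodMk_right, fun f => ?_⟩
  funext k
  by_cases hk : k ∈ S <;> simp [Equiv.piEquivPiSubtypeProd, Set.domRestrict, hk]

end Independence

section Graph

variable {ι : Type u} {γmax : ℕ}

theorem FTCG.time_le_of_reflTransGen (G : FTCG ι γmax) {p q : ι × ℤ}
    (h : Relation.ReflTransGen G.Adj p q) : p.2 ≤ q.2 := by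
  induction h with
  | refl => exact le_rfl
  | tail _ h ih => exact ih.trans (G.time_le h)

theorem FTCG.induction_from [Finite ι] (G : FTCG ι γmax) (c : ι × ℤ) {p : ι × ℤ → Prop} (self : p c)
    (past : ∀ q, q.2 < c.2 → p q)
    (step : ∀ q, q ≠ c → c.2 ≤ q.2 → (∀ r : G.Parent q.1, p (r.1.1, q.2 - r.1.2)) → p q)
    (q : ι × ℤ) : p q := by
  induction q using (G.wellFounded_from c.2).induction with
  | _ q ih =>
    by_cases hq : q = c
    · exact hq ▸ self
    rcases lt_or_ge q.2 c.2 with h | h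
    · exact past q h
    refine step q hq h fun r => ?_
    by_cases hr : c.2 ≤ q.2 - r.1.2
    · exact ih _ ⟨G.adj_of_parent r q.2, hr⟩
    · exact past _ (not_le.1 hr)

theorem finite_adjustmentB [Finite ι] (Ge : Digraph (ESCGVertex ι)) (X : ι) (t : ℤ) (γ : ℕ) :
    (adjustmentB γmax Ge X t γ).Finite := by
  refine (Set.finite_univ.prod (Set.finite_Icc (t - γ - γmax) (t - γ))).subset ?_
  rintro q (⟨Z, -, ℓ, -, hℓ, rfl⟩ | ⟨Z, -, rfl⟩) <;>
    simp only [Set.mem_prod, Set.mem_univ, Set.mem_Icc, true_and] <;> omega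

theorem FTCG.parent_mem_adjustmentB (G : FTCG ι γmax) {X : ι} (p : G.Parent X) (t : ℤ) (γ : ℕ) :
    (p.1.1, t - γ - (p.1.2 : ℤ)) ∈ adjustmentB γmax G.toESCG X t γ := by
  obtain ⟨⟨Z, ℓ⟩, hp⟩ := p
  rcases Nat.eq_zero_or_pos ℓ with rfl | hℓ
  · exact Or.inr ⟨Z, by simpa [FTCG.toESCG] using hp, by simp⟩
  · have hle : ℓ ≤ γmax := by simpa using G.lag_le hp
    exact Or.inl ⟨Z, ⟨ℓ, hℓ, hle, hp⟩, ℓ, hℓ, hle, rfl⟩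

theorem FTCG.not_descendant_of_mem_adjustmentB (G : FTCG ι γmax) {X : ι} {t : ℤ} {γ : ℕ}
    {q : ι × ℤ} (hq : q ∈ adjustmentB γmax G.toESCG X t γ) :
    ¬ Relation.ReflTransGen G.Adj (X, t - γ) q := by
  intro hdesc
  rcases hq with ⟨Z, -, ℓ, hℓ, -, rfl⟩ | ⟨Z, hZ, rfl⟩
  · have htime : t - γ ≤ t - γ - ℓ := G.time_le_of_reflTransGen hdesc
    omega
  · have hparent : G.Adj (Z, t - γ) (X, t - γ) := by simpa using G.shift (t - γ) hZ
    exact G.acyclic _ (Relation.TransGen.tail' hdesc hparent)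

end Graph

namespace DSCM

variable {ι : Type u} {γmax : ℕ} {G : FTCG ι γmax} {𝒳 : ι → Type v}
  [∀ i, MeasurableSpace (𝒳 i)] (M : DSCM.{u, v, w} G 𝒳)

open Classical in
/-- Everything outside the variable at `c` that determines the effect of an intervention at `c`: the
observed variables before the time of `c` and the noise from then on, except the noise at `c`. To
have complete trajectories, all the other coordinates are frozen at their values at `ω₀`. -/
noncomputable def background (c : ι × ℤ) (ω₀ ω : M.Ω) : Trajectory 𝒳 × Trajectory M.Noise :=
  ({q : ι × ℤ | q.2 < c.2}.piecewise (fun q => M.V q ω) (fun q => M.V q ω₀),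
    {q : ι × ℤ | c.2 ≤ q.2 ∧ q ≠ c}.piecewise (fun q => M.U q ω) (fun q => M.U q ω₀))

theorem indepFun_past_noise (c : ι × ℤ) :
    IndepFun (M.U c) (fun ω => ({q : ι × ℤ | c.2 ≤ q.2 ∧ q ≠ c}.domRestrict fun q => M.U q ω,
      {q : ι × ℤ | q.2 < c.2}.domRestrict fun q => M.V q ω)) M.μ := by
  refine indepFun_prodMk_of_indepFun_of_prodMk_indepFun (M.measurable_U c)
    (measurable_pi_lambda _ fun q => M.measurable_U _)
    (measurable_pi_lambda _ fun q => M.measurable_V _)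
    (indepFun_domRestrict_of_notMem M.measurable_U M.iIndepFun_U fun hc => hc.2 rfl) ?_
  let φ (n : ∀ q : {q : ι × ℤ // c.2 ≤ q.2}, M.Noise q.1.1) :
      M.Noise c.1 × ∀ q : {q : ι × ℤ | c.2 ≤ q.2 ∧ q ≠ c}, M.Noise q.1.1 :=
    (n ⟨c, le_rfl⟩, fun q => n ⟨q.1, q.2.1⟩)
  exact (M.indepFun_past c.2).comp (φ := φ) (by fun_prop) measurable_id

theorem exists_measurable_background_eq (c : ι × ℤ) (ω₀ : M.Ω) :
    ∃ φ : (∀ q : {q : ι × ℤ | c.2 ≤ q.2 ∧ q ≠ c}, M.Noise q.1.1) ×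
        (∀ q : {q : ι × ℤ | q.2 < c.2}, 𝒳 q.1.1) → Trajectory 𝒳 × Trajectory M.Noise,
      Measurable φ ∧ ∀ ω, M.background c ω₀ ω =
        φ ({q : ι × ℤ | c.2 ≤ q.2 ∧ q ≠ c}.domRestrict fun q => M.U q ω,
          {q : ι × ℤ | q.2 < c.2}.domRestrict fun q => M.V q ω) := by
  classical
  obtain ⟨φV, hφV, hV⟩ := exists_measurable_comp_domRestrict_eq_piecewise
    {q : ι × ℤ | q.2 < c.2} (fun q => M.V q ω₀)
  obtain ⟨φU, hφU, hU⟩ := exists_measurable_comp_domRestrict_eq_piecewise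
    {q : ι × ℤ | c.2 ≤ q.2 ∧ q ≠ c} (fun q => M.U q ω₀)
  refine ⟨fun p => (φV p.2, φU p.1), (hφV.comp measurable_snd).prodMk (hφU.comp measurable_fst),
    fun ω => ?_⟩
  simp only [background, hV, hU]

theorem measurable_background (c : ι × ℤ) (ω₀ : M.Ω) : Measurable (M.background c ω₀) := by
  obtain ⟨φ, hφ, h⟩ := M.exists_measurable_background_eq c ω₀
  rw [funext h]
  exact hφ.comp ((measurable_pi_lambda _ fun q => M.measurable_U _).prodMk
    (measurable_pi_lambda _ fun q => M.measurable_V _))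

theorem indepFun_background (c : ι × ℤ) (ω₀ : M.Ω) :
    IndepFun (M.background c ω₀) (M.U c) M.μ := by
  obtain ⟨φ, hφ, h⟩ := M.exists_measurable_background_eq c ω₀
  rw [funext h]
  exact (M.indepFun_past_noise c).symm.comp hφ measurable_id

/-- The trajectory `τ` satisfies all the structural equations of `M` when the noise variables take
the values `noise`. -/
def IsSolution (τ : Trajectory 𝒳) (noise : Trajectory M.Noise) : Prop :=
  ∀ q : ι × ℤ, τ q = M.mechanism q.1 (fun p => τ (p.1.1, q.2 - p.1.2)) (noise q)

theorem ae_isSolution [Countable ι] :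
    ∀ᵐ ω ∂M.μ, M.IsSolution (fun q => M.V q ω) (fun q => M.U q ω) :=
  ae_all_iff.2 fun q => M.structural_eq q.1 q.2

theorem measurable_mechanism_restrict {c : ι × ℤ} {B : Set (ι × ℤ)}
    (hpar : ∀ p : G.Parent c.1, (p.1.1, c.2 - (p.1.2 : ℤ)) ∈ B) :
    Measurable fun z : (∀ q : B, 𝒳 q.1.1) × M.Noise c.1 =>
      M.mechanism c.1 (fun p => z.1 ⟨_, hpar p⟩) z.2 := by
  have hparents : Measurable fun (z : ∀ q : B, 𝒳 q.1.1) (p : G.Parent c.1) => z ⟨_, hpar p⟩ :=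
    measurable_pi_lambda _ fun p => measurable_pi_apply _
  exact (M.measurable_mechanism c.1).comp (hparents.prodMap measurable_id)

theorem map_obsLaw {E : Type*} [MeasurableSpace E] {f : Trajectory 𝒳 → E} (hf : Measurable f) :
    M.obsLaw.map f = M.μ.map fun ω => f fun q => M.V q ω :=
  Measure.map_map hf (measurable_pi_lambda _ M.measurable_V)

variable [Finite ι]

theorem intervene_self (c : ι × ℤ) (x : 𝒳 c.1) (past : Trajectory 𝒳)
    (noise : Trajectory M.Noise) : M.intervene c x past noise c = x := by
  rw [intervene, WellFounded.fix_eq, dif_pos rfl]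

theorem intervene_of_lt {c q : ι × ℤ} (h : q.2 < c.2) (x : 𝒳 c.1) (past : Trajectory 𝒳)
    (noise : Trajectory M.Noise) : M.intervene c x past noise q = past q := by
  have hq : q ≠ c := fun hqc => h.ne (congrArg Prod.snd hqc)
  rw [intervene, WellFounded.fix_eq, dif_neg hq, if_pos h]

theorem intervene_of_ne {c q : ι × ℤ} (hq : q ≠ c) (h : c.2 ≤ q.2) (x : 𝒳 c.1)
    (past : Trajectory 𝒳) (noise : Trajectory M.Noise) :
    M.intervene c x past noise q =
      M.mechanism q.1 (fun p => M.intervene c x past noise (p.1.1, q.2 - p.1.2)) (noise q) := by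
  conv_lhs => rw [intervene, WellFounded.fix_eq]
  rw [dif_neg hq, if_neg h.not_gt]
  congr 1
  funext p
  split_ifs with hp
  · rfl
  · exact (M.intervene_of_lt (q := (p.1.1, q.2 - p.1.2)) (not_le.1 hp) x past noise).symm

theorem measurable_intervene (c q : ι × ℤ) :
    Measurable fun p : 𝒳 c.1 × Trajectory 𝒳 × Trajectory M.Noise =>
      M.intervene c p.1 p.2.1 p.2.2 q := by
  induction q using G.induction_from c with
  | self => simpa only [intervene_self] using measurable_fst
  | past q h =>
    simp only [M.intervene_of_lt h]
    exact (measurable_pi_apply q).comp measurable_snd.fst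
  | step q hq h ih =>
    simp only [M.intervene_of_ne hq h]
    exact (M.measurable_mechanism q.1).comp
      ((measurable_pi_lambda _ ih).prodMk ((measurable_pi_apply q).comp measurable_snd.snd))

theorem intervene_congr (c : ι × ℤ) (x : 𝒳 c.1) {past past' : Trajectory 𝒳}
    {noise noise' : Trajectory M.Noise} (hpast : ∀ q : ι × ℤ, q.2 < c.2 → past q = past' q)
    (hnoise : ∀ q : ι × ℤ, c.2 ≤ q.2 → q ≠ c → noise q = noise' q) :
    M.intervene c x past noise = M.intervene c x past' noise' := by
  funext q
  induction q using G.induction_from c with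
  | self => rw [intervene_self, intervene_self]
  | past q h => rw [M.intervene_of_lt h, M.intervene_of_lt h, hpast q h]
  | step q hq h ih =>
    rw [M.intervene_of_ne hq h, M.intervene_of_ne hq h, hnoise q h hq]
    simp only [ih]

theorem intervene_background (c : ι × ℤ) (x : 𝒳 c.1) (ω₀ ω : M.Ω) :
    M.intervene c x (M.background c ω₀ ω).1 (M.background c ω₀ ω).2 =
      M.intervene c x (fun q => M.V q ω) (fun q => M.U q ω) := by
  refine M.intervene_congr c x (fun q hq => ?_) fun q hq hqc => ?_
  · simp [background, hq]
  · simp [background, hq, hqc]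

variable {M} {τ : Trajectory 𝒳} {noise : Trajectory M.Noise}

theorem IsSolution.intervene_of_not_descendant (h : M.IsSolution τ noise) {c q : ι × ℤ}
    (x : 𝒳 c.1) (hq : ¬ Relation.ReflTransGen G.Adj c q) : M.intervene c x τ noise q = τ q := by
  induction q using G.induction_from c with
  | self => exact absurd .refl hq
  | past q hlt => rw [M.intervene_of_lt hlt]
  | step q hqc hle ih =>
    have hparents : ∀ p : G.Parent q.1, M.intervene c x τ noise (p.1.1, q.2 - p.1.2) =
        τ (p.1.1, q.2 - p.1.2) :=
      fun p => ih p fun hp => hq (hp.tail (G.adj_of_parent p q.2))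
    simp only [M.intervene_of_ne hqc hle, hparents, ← h q]

theorem IsSolution.intervene_eq_self (h : M.IsSolution τ noise) (c : ι × ℤ) :
    M.intervene c (τ c) τ noise = τ := by
  funext q
  induction q using G.induction_from c with
  | self => rw [intervene_self]
  | past q hlt => rw [M.intervene_of_lt hlt]
  | step q hqc hle ih => simp only [M.intervene_of_ne hqc hle, ih, ← h q]

variable (M)

theorem totalEffect_eq_map_background (c d : ι × ℤ) (x : 𝒳 c.1) (ω₀ : M.Ω) :
    M.totalEffect c d x = M.μ.map fun ω =>
      M.intervene c x (M.background c ω₀ ω).1 (M.background c ω₀ ω).2 d := by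
  simp only [totalEffect, intervene_background]

theorem ae_eq_intervene_background_of_not_descendant {c q : ι × ℤ} (x : 𝒳 c.1) (ω₀ : M.Ω)
    (hq : ¬ Relation.ReflTransGen G.Adj c q) :
    ∀ᵐ ω ∂M.μ, M.V q ω =
      M.intervene c x (M.background c ω₀ ω).1 (M.background c ω₀ ω).2 q := by
  filter_upwards [M.ae_isSolution] with ω hω
  rw [intervene_background, hω.intervene_of_not_descendant x hq]

theorem ae_eq_intervene_background (c q : ι × ℤ) (ω₀ : M.Ω) :
    ∀ᵐ ω ∂M.μ, M.V q ω =
      M.intervene c (M.V c ω) (M.background c ω₀ ω).1 (M.background c ω₀ ω).2 q := by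
  filter_upwards [M.ae_isSolution] with ω hω
  rw [intervene_background, hω.intervene_eq_self c]

end DSCM

namespace IsPositiveLaw

variable {ι : Type u} {𝒳 : ι → Type v} [∀ i, MeasurableSpace (𝒳 i)]
  {ν : ∀ i, Measure (𝒳 i)} {P : Measure (Trajectory 𝒳)}

theorem absolutelyContinuous_map_eval (h : IsPositiveLaw ν P) (c : ι × ℤ) :
    ν c.1 ≪ P.map fun τ => τ c := by
  have heval : Measurable fun z : (∀ q : ({c} : Set (ι × ℤ)), 𝒳 q.1.1) => z ⟨c, rfl⟩ :=
    measurable_pi_apply _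
  have hν := (measurePreserving_piUnique fun q : ({c} : Set (ι × ℤ)) => ν q.1.1).map_eq
  refine (Eq.symm hν).absolutelyContinuous.trans ?_
  have hmap := (h {c}).2.map heval
  rwa [Measure.map_map heval (by fun_prop)] at hmap

open Classical in
theorem prod_map_restrict_absolutelyContinuous [∀ i, SigmaFinite (ν i)]
    (h : IsPositiveLaw ν P) {s t : Finset (ι × ℤ)} (hst : Disjoint s t) :
    (P.map fun τ (q : s) => τ q).prod (P.map fun τ (q : t) => τ q) ≪
      P.map fun τ => (fun q : s => τ q, fun q : t => τ q) := by
  let e := MeasurableEquiv.piFinsetUnion (fun q : ι × ℤ => 𝒳 q.1) hst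
  have he := measurePreserving_piFinsetUnion hst fun q : ι × ℤ => ν q.1
  have hunion := (h ((s ∪ t : Finset (ι × ℤ)) : Set (ι × ℤ))).2.map e.symm.measurable
  rw [Measure.map_map e.symm.measurable (by fun_prop)] at hunion
  refine ((h (s : Set (ι × ℤ))).1.prod (h (t : Set (ι × ℤ))).1).trans ?_
  exact he.symm.map_eq.symm.absolutelyContinuous.trans hunion

theorem prod_map_eval_absolutelyContinuous [∀ i, SigmaFinite (ν i)] [SFinite P]
    (h : IsPositiveLaw ν P) {B : Set (ι × ℤ)} (hB : B.Finite) {c : ι × ℤ} (hc : c ∉ B) :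
    (P.map fun τ (q : B) => τ q).prod (P.map fun τ => τ c) ≪
      P.map fun τ => (fun q : B => τ q, τ c) := by
  lift B to Finset (ι × ℤ) using hB
  have heval : Measurable fun z : (∀ q : ({c} : Finset (ι × ℤ)), 𝒳 q.1.1) =>
      z ⟨c, Finset.mem_singleton_self c⟩ := measurable_pi_apply _
  have hmap := (h.prod_map_restrict_absolutelyContinuous
    (Finset.disjoint_singleton_right.2 hc)).map (measurable_id.prodMap heval)
  rw [← Measure.map_prod_map _ _ measurable_id heval, Measure.map_id,
    Measure.map_map heval (by fun_prop), Measure.map_map (by fun_prop) (by fun_prop)] at hmap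
  exact hmap

end IsPositiveLaw

section Adjustment

variable {ι : Type u} [Finite ι] {γmax : ℕ} {𝒳 : ι → Type v} [∀ i, MeasurableSpace (𝒳 i)]
  {ν : ∀ i, Measure (𝒳 i)}

namespace DSCM

variable {G : FTCG ι γmax} (M : DSCM.{u, v, w} G 𝒳) {c d : ι × ℤ} {B : Set (ι × ℤ)}
  [MeasurableSpace.CountablyGenerated (𝒳 c.1)] [StandardBorelSpace (𝒳 d.1)] [Nonempty (𝒳 d.1)]

theorem ae_totalEffect_eq_adjustmentFormula_of_prod_absolutelyContinuous
    (hpar : ∀ p : G.Parent c.1, (p.1.1, c.2 - (p.1.2 : ℤ)) ∈ B)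
    (hdesc : ∀ q ∈ B, ¬ Relation.ReflTransGen G.Adj c q)
    (hac : (M.obsLaw.map fun τ (q : B) => τ q).prod (M.obsLaw.map fun τ => τ c) ≪
      M.obsLaw.map fun τ => (fun q : B => τ q, τ c)) :
    ∀ᵐ x ∂M.obsLaw.map fun τ => τ c,
      M.totalEffect c d x = adjustmentFormula M.obsLaw c d B x := by
  obtain ⟨ω₀⟩ := nonempty_of_isProbabilityMeasure M.μ
  have hB : (fun ω (q : B) => M.V q ω) =ᵐ[M.μ] fun ω (q : B) =>
      M.intervene c (M.V c ω₀) (M.background c ω₀ ω).1 (M.background c ω₀ ω).2 q := by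
    filter_upwards [ae_all_iff.2 fun q : B =>
      M.ae_eq_intervene_background_of_not_descendant (M.V c ω₀) ω₀ (hdesc q q.2)] with ω hω
    exact funext hω
  have hX : M.V c =ᵐ[M.μ] fun ω =>
      M.mechanism c.1 (fun p => (fun q : B => M.V q ω) ⟨_, hpar p⟩) (M.U c ω) :=
    M.structural_eq c.1 c.2
  have hcond := compProd_map_condDistrib (μ := M.obsLaw) (mβ := inferInstance)
    (X := fun τ : Trajectory 𝒳 => (τ c, fun q : B => τ q)) (measurable_pi_apply d).aemeasurable
  rw [M.map_obsLaw (by fun_prop), M.map_obsLaw (by fun_prop)] at hcond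
  rw [M.map_obsLaw (by fun_prop), M.map_obsLaw (by fun_prop), M.map_obsLaw (by fun_prop)] at hac
  rw [M.map_obsLaw (by fun_prop)]
  have hadjust := ae_map_eq_bind_of_indepFun
    (M.measurable_V c) (M.measurable_background c ω₀) (M.measurable_U c)
    (b := fun (r : Trajectory 𝒳 × Trajectory M.Noise) (q : B) => M.intervene c (M.V c ω₀) r.1 r.2 q)
    (F := fun z => M.mechanism c.1 (fun p => z.1 ⟨_, hpar p⟩) z.2)
    (g := fun p => M.intervene c p.1 p.2.1 p.2.2 d)
    (measurable_pi_lambda _ fun q => (M.measurable_intervene c q).comp measurable_prodMk_left)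
    (M.measurable_mechanism_restrict hpar) (M.measurable_intervene c d)
    (M.indepFun_background c ω₀) hB hX (M.ae_eq_intervene_background c d ω₀) hac hcond.symm
  filter_upwards [hadjust] with x hx
  rw [M.totalEffect_eq_map_background c d x ω₀, hx, adjustmentFormula, M.map_obsLaw (by fun_prop)]

theorem ae_totalEffect_eq_adjustmentFormula [∀ i, SigmaFinite (ν i)]
    (hν : IsPositiveLaw ν M.obsLaw) (hfin : B.Finite)
    (hpar : ∀ p : G.Parent c.1, (p.1.1, c.2 - (p.1.2 : ℤ)) ∈ B)
    (hdesc : ∀ q ∈ B, ¬ Relation.ReflTransGen G.Adj c q) :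
    ∀ᵐ x ∂ν c.1, M.totalEffect c d x = adjustmentFormula M.obsLaw c d B x := by
  have hcB : c ∉ B := fun hc => hdesc c hc .refl
  exact (hν.absolutelyContinuous_map_eval c).ae_le <|
    M.ae_totalEffect_eq_adjustmentFormula_of_prod_absolutelyContinuous hpar hdesc
      (hν.prod_map_eval_absolutelyContinuous hfin hcB)

end DSCM

variable [∀ i, StandardBorelSpace (𝒳 i)] [∀ i, Nonempty (𝒳 i)]

theorem isValidAdjustmentSet_adjustmentB [∀ i, SigmaFinite (ν i)] (Ge : Digraph (ESCGVertex ι))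
    (X Y : ι) (t : ℤ) (γ : ℕ) :
    IsValidAdjustmentSet.{u, v, w} γmax ν Ge (X, t - γ) (Y, t) (adjustmentB γmax Ge X t γ) := by
  rintro G rfl M hM
  exact M.ae_totalEffect_eq_adjustmentFormula hM (finite_adjustmentB _ X t γ)
    (fun p => G.parent_mem_adjustmentB p t γ) fun q hq => G.not_descendant_of_mem_adjustmentB hq

open Classical in
theorem IsValidAdjustmentSet.isIdentifiable {Ge : Digraph (ESCGVertex ι)} {c d : ι × ℤ}
    {B : Set (ι × ℤ)} (h : IsValidAdjustmentSet.{u, v, w} γmax ν Ge c d B) :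
    IsIdentifiable.{u, v, w} γmax ν Ge c d := by
  refine ⟨fun P x => if hP : IsFiniteMeasure P then adjustmentFormula P c d B x else 0,
    fun G hG M hM => ?_⟩
  filter_upwards [h G hG M hM] with x hx
  rw [hx, dif_pos (inferInstanceAs (IsFiniteMeasure M.obsLaw))]

end Adjustment

theorem mainTheorem1 {ι : Type u} [Finite ι] (γmax : ℕ) (𝒳 : ι → Type v)
    [∀ i, MeasurableSpace (𝒳 i)] [∀ i, StandardBorelSpace (𝒳 i)] [∀ i, Nonempty (𝒳 i)]
    (ν : ∀ i, Measure (𝒳 i)) [∀ i, SigmaFinite (ν i)]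
    (Ge : Digraph (ESCGVertex ι)) (X Y : ι) (t : ℤ) (γ : ℕ) :
    IsIdentifiable.{u, v, w} γmax ν Ge (X, t - γ) (Y, t) ∧
    IsValidAdjustmentSet.{u, v, w} γmax ν Ge (X, t - γ) (Y, t) (adjustmentB γmax Ge X t γ) :=
  have hvalid := isValidAdjustmentSet_adjustmentB Ge X Y t γ
  ⟨hvalid.isIdentifiable, hvalid⟩
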